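/- Let $R$ be an integral domain that is a $\mathbb{C}$-algebra, let $n\ge 1$ and $0\le k\le n$ be integers, let $a,b\in R$, and let $q\in R$ be invertible with an $n$-th root in $R$ (for instance $R=\mathbb{C}[q^{\pm 1/n}][a,b]$ with $q^{1/n},a,b$ indeterminates). Let $x$ be a formal variable. Let $V=\mathbb{C}v_0\oplus\mathbb{C}v_1$. For a vertex whose west, north, east and south edges have values $W,N,E,S\in\{0,1\}$ define the free-fermion Boltzmann weights $$\Omega(0,0,0,0)=1,\quad \Omega(1,1,1,1)=ax,\quad \Omega(0,1,0,1)=1,\quad \Omega(1,0,1,0)=bx,\quad \Omega(1,0,0,1)=1,\quad \Omega(0,1,1,0)=(a+b)x,$$ and $\Omega(W,N,E,S)=0$ for all other values. The transfer matrix with quasi-periodic boundary conditions $\tau(x;a,b)=A+qD$ is the operator on $R[x]\otimes V^{\otimes n}$ given by $$\tau(x;a,b)\,v_{\sigma_1}\otimes\cdots\otimes v_{\sigma_n}=\sum_{\sigma'\in\{0,1\}^n}\ \sum_{\substack{h_0,\dots,h_n\in\{0,1\}\\ h_0=h_n}}q^{h_0}\prod_{j=1}^n\Omega(h_{j-1},\sigma_j,h_j,\sigma'_j)\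 v_{\sigma'_1}\otimes\cdots\otimes v_{\sigma'_n}.$$ It preserves $R[x]\otimes V_k$, where $V_k\subset V^{\otimes n}$ is the span of the vectors $v_{\sigma_1}\otimes\cdots\otimes v_{\sigma_n}$ with exactly $k$ of the $\sigma_i$ equal to $1$. **Proposition.** The set $\Xi$ of all $k$-element sets $\{\xi_1,\dots,\xi_k\}\subset R$ of distinct solutions of the Bethe ansatz equations $$\xi_i^n+(-1)^kq=0,\qquad i=1,\dots,k,$$ has $\binom nk=\dim V_k$ elements. The restriction of $\tau(x;a,b)$ to $V_k$ is diagonalisable: the free $R$-module $R\otimes V_k$ has a basis $(v_\xi)_{\xi\in\Xi}$, not involving $x$, with $$\tau(x;a,b)\,v_\xi=(1+(-1)^kq\,x^nb^n)\prod_{i=1}^k\frac{1+ax\xi_i}{1-bx\xi_i}\;v_\xi\qquad\text{for all }\xi\in\Xi .$$ The Bethe ansatz is complete: an element of the field of fractions of $R[x]$ is an eigenvalue of the restriction of $\tau(x;a,b)$ to $V_k$ if and only if it is one of these rational functions for some $\xi\in\Xi$. -/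

import Mathlib

open Polynomial

noncomputable section

namespace SixVertex

/-- The six Boltzmann weights `ω₁, …, ω₆` of the asymmetric six-vertex model. -/
structure Weights (S : Type*) where
  w1 : S
  w2 : S
  w3 : S
  w4 : S
  w5 : S
  w6 : S

/-- The weight `Ω(W, N, E, S)` of a single vertex, as a function of the values (`false` for `0`,
`true` for `1`) of its west, north, east and south edges. All other configurations are
forbidden. -/
def vertexWeight {S : Type*} [Zero S] (ω : Weights S) : Bool → Bool → Bool → Bool → S
  | false, false, false, false => ω.w1
  | true, true, true, true => ω.w2
  | false, true, false, true => ω.w3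
  | true, false, true, false => ω.w4
  | true, false, false, true => ω.w5
  | false, true, true, false => ω.w6
  | _, _, _, _ => 0

/-- The row-to-row transfer matrix of a row with `n` vertices whose outer left horizontal edge has
value `α` and whose outer right one has value `β`. The row index is the binary string of the
vertical edges on the bottom, the column index the one of those on top; the entry is the sum over
all values `h 0, …, h n` of the horizontal edges (from left to right) compatible with `α`, `β`.
The operators `A` and `D` of the Yang-Baxter algebra are `rowTransfer n ω false false` and
`rowTransfer n ω true true`. -/
def rowTransfer {S : Type*} [CommRing S] (n : ℕ) (ω : Weights S) (α β : Bool) :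
    Matrix (Fin n → Bool) (Fin n → Bool) S :=
  Matrix.of fun bottom top =>
    ∑ h : Fin (n + 1) → Bool,
      if h 0 = α ∧ h (Fin.last n) = β then
        ∏ j : Fin n, vertexWeight ω (h j.castSucc) (top j) (h j.succ) (bottom j)
      else 0

/-- The transfer matrix with quasi-periodic boundary conditions `τ = A + q D`, with respect to the
standard basis of `V^{⊗ n}`, whose elements are labelled by binary strings of length `n`. -/
def transferMatrix {S : Type*} [CommRing S] (n : ℕ) (ω : Weights S) (q : S) :
    Matrix (Fin n → Bool) (Fin n → Bool) S :=
  rowTransfer n ω false false + q • rowTransfer n ω true true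

/-- The free-fermion weights with parameters `a`, `b` and spectral parameter `x`. -/
def freeFermion {S : Type*} [CommRing S] (a b x : S) : Weights S where
  w1 := 1
  w2 := a * x
  w3 := 1
  w4 := b * x
  w5 := 1
  w6 := (a + b) * x

/-- The number of `1`-letters of a binary string. -/
def numOnes {n : ℕ} (σ : Fin n → Bool) : ℕ := ∑ i, (σ i).toNat

/-- The subspace `V_k` of `V^{⊗ n}` (with scalars in `S`): the vectors supported on the basis
vectors `v_σ` where `σ` has exactly `k` letters `1`. -/
def sector (S : Type*) [CommRing S] (n k : ℕ) : Submodule S ((Fin n → Bool) → S) where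
  carrier := {f | ∀ σ, numOnes σ ≠ k → f σ = 0}
  add_mem' := by
    intro f g hf hg σ hσ
    simp [hf σ hσ, hg σ hσ]
  zero_mem' := by
    intro σ _
    rfl
  smul_mem' := by
    intro c f hf σ hσ
    simp [hf σ hσ]

theorem vertexWeight_eq_zero {S : Type*} [CommRing S] (ω : Weights S) (W N E So : Bool)
    (h : W.toNat + N.toNat ≠ E.toNat + So.toNat) : vertexWeight ω W N E So = 0 := by
  cases W <;> cases N <;> cases E <;> cases So <;> simp_all [vertexWeight]

theorem rowTransfer_eq_zero {S : Type*} [CommRing S] (n : ℕ) (ω : Weights S) (α : Bool)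
    (bottom top : Fin n → Bool) (hne : numOnes bottom ≠ numOnes top) :
    rowTransfer n ω α α bottom top = 0 := by
  unfold rowTransfer
  rw [Matrix.of_apply]
  refine Finset.sum_eq_zero fun h _ => ?_
  split_ifs with hb
  · by_contra hprod
    apply hne
    have hice : ∀ j : Fin n, (h j.castSucc).toNat + (top j).toNat
        = (h j.succ).toNat + (bottom j).toNat := by
      intro j
      by_contra hj
      exact hprod (Finset.prod_eq_zero (Finset.mem_univ j) (vertexWeight_eq_zero ω _ _ _ _ hj))
    have hsum : (∑ j : Fin n, (h j.castSucc).toNat) + numOnes top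
        = (∑ j : Fin n, (h j.succ).toNat) + numOnes bottom := by
      simp only [numOnes, ← Finset.sum_add_distrib]
      exact Finset.sum_congr rfl fun j _ => hice j
    have h1 := Fin.sum_univ_succ (fun i : Fin (n + 1) => (h i).toNat)
    have h2 := Fin.sum_univ_castSucc (fun i : Fin (n + 1) => (h i).toNat)
    rw [hb.1] at h1
    rw [hb.2] at h2
    omega
  · rfl

/-- The transfer matrix conserves the number of `1`-letters. -/
theorem transferMatrix_mem_sector {S : Type*} [CommRing S] (n k : ℕ) (ω : Weights S) (q : S) :
    ∀ f ∈ sector S n k, (transferMatrix n ω q).mulVecLin f ∈ sector S n k := by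
  intro f hf σ hσ
  rw [Matrix.mulVecLin_apply]
  refine Finset.sum_eq_zero fun ρ _ => ?_
  by_cases hρ : numOnes ρ = k
  · have hne : numOnes σ ≠ numOnes ρ := by rw [hρ]; exact hσ
    simp [transferMatrix, rowTransfer_eq_zero n ω _ σ ρ hne]
  · simp [hf ρ hρ]

/-- The restriction of the quasi-periodic transfer matrix at the free-fermion weights,
`τ(x; a, b)`, to `V_k`. -/
def sectorTransfer {S : Type*} [CommRing S] (n k : ℕ) (q a b x : S) :
    Module.End S (sector S n k) :=
  (transferMatrix n (freeFermion a b x) q).mulVecLin.restrict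
    (transferMatrix_mem_sector n k (freeFermion a b x) q)

/-- Extension of scalars `V_k → L ⊗ V_k` for an `R`-algebra `L`. -/
def sectorMap {R : Type*} [CommRing R] (L : Type*) [CommRing L] [Algebra R L] {n k : ℕ}
    (v : sector R n k) : sector L n k :=
  ⟨fun σ => algebraMap R L ((v : (Fin n → Bool) → R) σ), fun σ hσ => by
    simp [v.2 σ hσ]⟩

/-- The solutions of the Bethe ansatz equations: sets `{ξ₁, …, ξ_k}` of `k` distinct solutions of
`ξ ^ n + (-1) ^ k * q = 0`. -/
abbrev BetheSolution (R : Type*) [CommRing R] (n k : ℕ) (q : R) : Type _ :=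
  {s : Finset R // s.card = k ∧ ∀ ξ ∈ s, ξ ^ n + (-1) ^ k * q = 0}

/-- The field of fractions of `R[x]`, where `x` is a formal variable. -/
abbrev SpectralField (R : Type*) [CommRing R] : Type _ := FractionRing R[X]

/-- The spectral parameter `x`, as an element of the field of fractions of `R[x]`. -/
def spectralX (R : Type*) [CommRing R] : SpectralField R :=
  algebraMap R[X] (SpectralField R) X

/-- The rational function
`(1 + (-1) ^ k q x ^ n b ^ n) ∏ ξ ∈ s, (1 + a x ξ) / (1 - b x ξ)` of the formal variable `x`. -/
def betheEigenvalue {R : Type*} [CommRing R] [IsDomain R] (n k : ℕ) (q a b : R)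
    (s : Finset R) : SpectralField R :=
  let ι := algebraMap R (SpectralField R)
  let x := spectralX R
  (1 + (-1) ^ k * ι q * x ^ n * ι b ^ n) * ∏ ξ ∈ s, (1 + ι a * x * ι ξ) / (1 - ι b * x * ι ξ)

end SixVertex

end

noncomputable section

namespace SixVertex

open Matrix

variable {S : Type*} [CommRing S]

/-! The Bethe vectors are free-fermion states. The Jordan–Wigner signs turn the insertion of a
letter `1` into anticommuting operators `ψ*_j`, and `Ψ(ξ) = ∑ j, ξ ^ (n - 1 - j) ψ*_j` (sites
numbered from `0`) creates a plane wave. At the free-fermion weights, `(1 - bxξ) T Ψ(ξ)` and `(1 +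
axξ) Ψ(ξ) T` differ, up to a sign, only by terms at the two ends of the row
(`rowTransfer_telescope`). In `τ = A + qD` acting on `V_k` these end terms cancel if `ξ ^ n = (-1) ^
k q`, and `q` becomes `-q` once `Ψ(ξ)` has been moved to the left (`transferMatrix_mul_creation`).
The flip of the twist compensates the change in particle number, so all wave numbers of a Bethe
vector obey one and the same equation `ξ ^ n = Q`, and the eigenvalue is read off at the vacuum
(`transferMatrix_mulVec_betheVector`).

Completeness is Fourier analysis: the `n` roots of `ξ ^ n = Q` are distinct and their plane waves
span all of `R ^ n` (`single_eq_sum_planeWave`), so products of the `Ψ(ξ)` applied to the vacuum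
span `V_k`. By anticommutation only `k`-element sets of roots matter; there are `n.choose k` of
them, the rank of `V_k`, so the spanning family is a basis. It stays one over the field of fractions
of `R[x]`, which leaves no room for further eigenvalues. -/

/-- The sign attached to a letter: `-1` for an occupied site, `1` for an empty one. -/
def parity (S : Type*) [CommRing S] (b : Bool) : S := if b then -1 else 1

@[simp] theorem parity_true : parity S true = -1 := rfl

@[simp] theorem parity_false : parity S false = 1 := rfl

/-- The Jordan–Wigner sign: the parity of the number of ones to the left of the site `j`. -/
def jordanWigner (S : Type*) [CommRing S] {n : ℕ} (σ : Fin n → Bool) (j : Fin n) : S :=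
  ∏ i, if i < j then parity S (σ i) else 1

@[simp] theorem jordanWigner_zero {n : ℕ} (σ : Fin (n + 1) → Bool) : jordanWigner S σ 0 = 1 := by
  simp [jordanWigner]

@[simp] theorem jordanWigner_cons_succ {n : ℕ} (s : Bool) (σ : Fin n → Bool) (j : Fin n) :
    jordanWigner S (Fin.cons s σ : Fin (n + 1) → Bool) j.succ
      = parity S s * jordanWigner S σ j := by
  simp [jordanWigner, Fin.prod_univ_succ]

/-! ### Recursion along the row and the telescoping relation -/

/-- Peels off the leftmost vertex: its west edge is forced to be `α`, so only its east edge is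
summed over. -/
theorem rowTransfer_cons {n : ℕ} (ω : Weights S) (α β s t : Bool) (σ τ : Fin n → Bool) :
    rowTransfer (n + 1) ω α β (Fin.cons s σ) (Fin.cons t τ)
      = vertexWeight ω α t false s * rowTransfer n ω false β σ τ
        + vertexWeight ω α t true s * rowTransfer n ω true β σ τ := by
  simp only [rowTransfer, Matrix.of_apply, Finset.mul_sum]
  rw [← Finset.sum_add_distrib, ← (Fin.consEquiv fun _ : Fin (n + 2) => Bool).sum_comp,
    Fintype.sum_prod_type, Finset.sum_comm]
  refine Finset.sum_congr rfl fun h _ => ?_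
  rw [Finset.sum_eq_single α]
  · have hlast : (Fin.cons α h : Fin (n + 2) → Bool) (Fin.last (n + 1)) = h (Fin.last n) := by
      rw [← Fin.succ_last, Fin.cons_succ]
    have hcast (j : Fin n) : (Fin.cons α h : Fin (n + 2) → Bool) j.succ.castSucc
        = h j.castSucc := by
      rw [← Fin.succ_castSucc, Fin.cons_succ]
    simp only [Fin.consEquiv_apply, Fin.prod_univ_succ, hlast, hcast]
    cases h0 : h 0 <;> simp [h0]
  · intro γ _ hγ
    simp [hγ]
  · simp

theorem rowTransfer_zero (ω : Weights S) (α β : Bool) (σ τ : Fin 0 → Bool) :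
    rowTransfer 0 ω α β σ τ = if α = β then 1 else 0 := by
  have h : ∀ h : Fin 1 → Bool, h (Fin.last 0) = h 0 := fun h => rfl
  simp only [rowTransfer, Matrix.of_apply, h, Finset.univ_eq_empty, Finset.prod_empty]
  rw [← (Equiv.funUnique (Fin 1) Bool).symm.sum_comp]
  cases α <;> cases β <;> simp

theorem rowTransfer_vacuum (n : ℕ) (a b x : S) :
    rowTransfer n (freeFermion a b x) false false (fun _ => false) (fun _ => false) = 1 ∧
    rowTransfer n (freeFermion a b x) true true (fun _ => false) (fun _ => false)
      = (b * x) ^ n := by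
  induction n with
  | zero => simp [rowTransfer_zero]
  | succ n ih =>
    have h : (fun _ => false : Fin (n + 1) → Bool)
        = Fin.cons false (fun _ => false : Fin n → Bool) := by
      ext i; refine Fin.cases rfl (fun _ => rfl) i
    rw [h, rowTransfer_cons, rowTransfer_cons, ih.1, ih.2]
    simp [vertexWeight, freeFermion, pow_succ']

/-- The intertwining relation between the monodromy matrix and a plane wave creation operator,
before closing the boundary: the difference telescopes to boundary terms. -/
theorem rowTransfer_telescope (a b x ξ : S) (n : ℕ) (w : Fin (n + 1) → S)
    (hw : ∀ j : Fin n, w j.castSucc = ξ * w j.succ) (σ τ : Fin n → Bool) (α β : Bool) :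
    (1 - b * x * ξ) * (∑ j, if τ j then 0 else w j.succ * jordanWigner S τ j *
        rowTransfer n (freeFermion a b x) α β σ (Function.update τ j true))
      - (1 + a * x * ξ) * parity S α * (∑ j, if σ j then w j.succ * jordanWigner S σ j *
        rowTransfer n (freeFermion a b x) α β (Function.update σ j false) τ else 0)
      = -((a + b) * x) *
        ((if α then 0 else w 0 * rowTransfer n (freeFermion a b x) true β σ τ)
          - (if β then w (Fin.last n) * (∏ i, parity S (τ i)) *
              rowTransfer n (freeFermion a b x) α false σ τ else 0)) := by
  -- The east edge of the first vertex becomes the left boundary value of the shorter row, so `α`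
  -- has to vary.
  induction n generalizing α with
  | zero => cases α <;> cases β <;> simp [rowTransfer_zero]
  | succ n ih =>
    obtain ⟨s, σ, rfl⟩ : ∃ s σ', σ = Fin.cons s σ' := ⟨σ 0, Fin.tail σ, (Fin.cons_self_tail σ).symm⟩
    obtain ⟨t, τ, rfl⟩ : ∃ t τ', τ = Fin.cons t τ' := ⟨τ 0, Fin.tail τ, (Fin.cons_self_tail τ).symm⟩
    have h0 : w 0 = ξ * w 1 := by simpa using hw 0
    have ih' := ih (fun j => w j.succ) (fun j => by simpa using hw j.succ) σ τ
    have e (ρ : Fin n → Bool) (r c : Bool) (j : Fin n) :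
        Function.update (Fin.cons r ρ : Fin (n + 1) → Bool) j.succ c
          = Fin.cons r (Function.update ρ j c) := (Fin.cons_update ..).symm
    simp only [Fin.sum_univ_succ, Fin.cons_zero, Fin.cons_succ, jordanWigner_zero,
      jordanWigner_cons_succ, Fin.update_cons_zero, e, rowTransfer_cons, Fin.prod_univ_succ]
    simp only [Fin.succ_zero_eq_one, Fin.succ_last] at ih' ⊢
    have hsum1 (p A B : S) : (∑ j, if τ j = true then 0 else w j.succ.succ *
          (p * jordanWigner S τ j) *
          (A * rowTransfer n (freeFermion a b x) false β σ (Function.update τ j true)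
          + B * rowTransfer n (freeFermion a b x) true β σ (Function.update τ j true)))
        = p * A * (∑ j, if τ j = true then 0 else w j.succ.succ * jordanWigner S τ j *
          rowTransfer n (freeFermion a b x) false β σ (Function.update τ j true))
        + p * B * (∑ j, if τ j = true then 0 else w j.succ.succ * jordanWigner S τ j *
          rowTransfer n (freeFermion a b x) true β σ (Function.update τ j true)) := by
      simp only [Finset.mul_sum, ← Finset.sum_add_distrib]
      refine Finset.sum_congr rfl fun j _ => ?_
      split_ifs <;> ring
    have hsum2 (p A B : S) : (∑ j, if σ j = true then w j.succ.succ *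
          (p * jordanWigner S σ j) *
          (A * rowTransfer n (freeFermion a b x) false β (Function.update σ j false) τ
          + B * rowTransfer n (freeFermion a b x) true β (Function.update σ j false) τ) else 0)
        = p * A * (∑ j, if σ j = true then w j.succ.succ * jordanWigner S σ j *
          rowTransfer n (freeFermion a b x) false β (Function.update σ j false) τ else 0)
        + p * B * (∑ j, if σ j = true then w j.succ.succ * jordanWigner S σ j *
          rowTransfer n (freeFermion a b x) true β (Function.update σ j false) τ else 0) := by
      simp only [Finset.mul_sum, ← Finset.sum_add_distrib]
      refine Finset.sum_congr rfl fun j _ => ?_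
      split_ifs <;> ring
    rw [hsum1, hsum2]
    have hf := ih' false
    have ht := ih' true
    clear ih ih' hsum1 hsum2
    rw [h0]
    simp only [parity_true, parity_false, if_true, Bool.false_eq_true, if_false] at hf ht
    generalize (∑ j, if τ j = true then 0 else w j.succ.succ * jordanWigner S τ j *
          rowTransfer n (freeFermion a b x) false β σ (Function.update τ j true)) = A0 at *
    generalize (∑ j, if τ j = true then 0 else w j.succ.succ * jordanWigner S τ j *
          rowTransfer n (freeFermion a b x) true β σ (Function.update τ j true)) = A1 at *
    generalize (∑ j, if σ j = true then w j.succ.succ * jordanWigner S σ j *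
          rowTransfer n (freeFermion a b x) false β (Function.update σ j false) τ else 0) = B0 at *
    generalize (∑ j, if σ j = true then w j.succ.succ * jordanWigner S σ j *
          rowTransfer n (freeFermion a b x) true β (Function.update σ j false) τ else 0) = B1 at *
    generalize rowTransfer n (freeFermion a b x) true β σ τ = T1 at hf ht ⊢
    generalize rowTransfer n (freeFermion a b x) false β σ τ = T0 at hf ht ⊢
    generalize rowTransfer n (freeFermion a b x) true false σ τ = T1' at hf ht ⊢
    generalize rowTransfer n (freeFermion a b x) false false σ τ = T0' at hf ht ⊢
    -- By the ice rule `α`, `s`, `t` leave at most one value for the east edge of the first vertex,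
    -- so one multiple of `hf` or `ht` suffices. If no value is allowed, only terms from the first
    -- site can survive; for `α = 0`, `s = 1`, `t = 0` they cancel because `(1 - bxξ) - (1 + axξ) =
    -- -(a + b)xξ`.
    cases α <;> cases s <;> cases t <;>
      simp only [vertexWeight, freeFermion, parity_true, parity_false, if_true,
        Bool.false_eq_true, if_false] <;> cases β <;>
      simp only [if_true, Bool.false_eq_true, if_false] at hf ht ⊢
    all_goals first
      | linear_combination hf
      | linear_combination -hf
      | linear_combination ht
      | linear_combination (b * x) * ht
      | linear_combination (- (a * x)) * ht
      | linear_combination (-((a + b) * x)) * ht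
      | linear_combination (0 : S) * ht

/-! ### Fermionic creation operators -/

/-- The matrix of the fermionic creation operator `∑ j, u j ψ*_j` on `V^{⊗ n}`. -/
def creation {n : ℕ} (u : Fin n → S) : Matrix (Fin n → Bool) (Fin n → Bool) S :=
  Matrix.of fun σ τ => ∑ j, if τ j = false ∧ σ = Function.update τ j true then
    u j * jordanWigner S τ j else 0

theorem jordanWigner_update_self {n : ℕ} (σ : Fin n → Bool) (j : Fin n) (c : Bool) :
    jordanWigner S (Function.update σ j c) j = jordanWigner S σ j := by
  refine Finset.prod_congr rfl fun i _ => ?_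
  split_ifs with h
  · rw [Function.update_of_ne h.ne]
  · rfl

theorem jordanWigner_update_of_ne {n : ℕ} (σ : Fin n → Bool) {i j : Fin n} (hi : σ i = false) :
    jordanWigner S (Function.update σ i true) j
      = (if i < j then -1 else 1) * jordanWigner S σ j := by
  unfold jordanWigner
  rw [← Finset.mul_prod_erase _ _ (Finset.mem_univ i),
    ← Finset.mul_prod_erase _ (fun k => if k < j then parity S (σ k) else 1) (Finset.mem_univ i),
    ← mul_assoc]
  congr 1
  · split_ifs <;> simp [hi]
  · refine Finset.prod_congr rfl fun k hk => ?_
    rw [Function.update_of_ne (Finset.ne_of_mem_erase hk)]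

theorem parity_mul_self (b : Bool) : parity S b * parity S b = 1 := by cases b <;> simp

theorem jordanWigner_mul_self {n : ℕ} (σ : Fin n → Bool) (j : Fin n) :
    jordanWigner S σ j * jordanWigner S σ j = 1 := by
  unfold jordanWigner
  rw [← Finset.prod_mul_distrib]
  refine Finset.prod_eq_one fun i _ => ?_
  split_ifs <;> simp [parity_mul_self]

theorem prod_parity {n : ℕ} (σ : Fin n → Bool) : ∏ i, parity S (σ i) = (-1) ^ numOnes σ := by
  rw [numOnes, ← Finset.prod_pow_eq_pow_sum]
  refine Finset.prod_congr rfl fun i _ => ?_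
  cases σ i <;> simp

theorem numOnes_update {n : ℕ} {σ : Fin n → Bool} {j : Fin n} (hj : σ j = false) :
    numOnes (Function.update σ j true) = numOnes σ + 1 := by
  unfold numOnes
  rw [← Finset.add_sum_erase _ _ (Finset.mem_univ j),
    ← Finset.add_sum_erase _ (fun i => (σ i).toNat) (Finset.mem_univ j)]
  have : ∑ i ∈ Finset.univ.erase j, (Function.update σ j true i).toNat
      = ∑ i ∈ Finset.univ.erase j, (σ i).toNat :=
    Finset.sum_congr rfl fun i hi => by rw [Function.update_of_ne (Finset.ne_of_mem_erase hi)]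
  rw [this, Function.update_self, hj]
  simp [add_comm]

/-- The condition defining `creation`, expressed through the image configuration. -/
theorem eq_update_true_iff {n : ℕ} (σ τ : Fin n → Bool) (j : Fin n) :
    (τ j = false ∧ σ = Function.update τ j true)
      ↔ (σ j = true ∧ τ = Function.update σ j false) := by
  constructor
  · rintro ⟨h, rfl⟩
    simp [← h]
  · rintro ⟨h, rfl⟩
    simp [← h]

theorem mul_creation_apply {n : ℕ} (A : Matrix (Fin n → Bool) (Fin n → Bool) S) (u : Fin n → S)
    (σ τ : Fin n → Bool) : (A * creation u) σ τ
      = ∑ j, if τ j then 0 else u j * jordanWigner S τ j * A σ (Function.update τ j true) := by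
  simp only [Matrix.mul_apply, creation, Matrix.of_apply, Finset.mul_sum]
  rw [Finset.sum_comm]
  refine Finset.sum_congr rfl fun j _ => ?_
  cases h : τ j
  · simp [mul_comm]
  · simp

theorem creation_mul_apply {n : ℕ} (A : Matrix (Fin n → Bool) (Fin n → Bool) S) (u : Fin n → S)
    (σ τ : Fin n → Bool) : (creation u * A) σ τ
      = ∑ j, if σ j then u j * jordanWigner S σ j * A (Function.update σ j false) τ else 0 := by
  simp only [Matrix.mul_apply, creation, Matrix.of_apply, Finset.sum_mul, eq_update_true_iff]
  rw [Finset.sum_comm]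
  refine Finset.sum_congr rfl fun j _ => ?_
  cases h : σ j
  · simp
  · simp [jordanWigner_update_self]

theorem creation_anticommute {n : ℕ} (u v : Fin n → S) :
    creation u * creation v = -(creation v * creation u) := by
  ext σ τ
  rw [Matrix.neg_apply, mul_creation_apply, mul_creation_apply]
  -- Both products become sums over ordered pairs of distinct empty sites, `i` being filled before
  -- `j`. Filling `i` changes the sign at `j` only if `i < j`, so exchanging the two sites reverses
  -- the sign.
  have key (u v : Fin n → S) : (∑ i, if τ i then 0 else
        v i * jordanWigner S τ i * creation u σ (Function.update τ i true))
      = ∑ i, ∑ j, if τ i = false ∧ τ j = false ∧ i ≠ j ∧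
          σ = Function.update (Function.update τ i true) j true then
          (if i < j then -1 else 1) * (jordanWigner S τ i * jordanWigner S τ j * (v i * u j))
          else 0 := by
    refine Finset.sum_congr rfl fun i _ => ?_
    cases hi : τ i
    · simp only [Bool.false_eq_true, if_false, creation, Matrix.of_apply, Finset.mul_sum]
      refine Finset.sum_congr rfl fun j _ => ?_
      rcases eq_or_ne i j with rfl | hij
      · simp
      · simp only [Function.update_of_ne hij.symm, jordanWigner_update_of_ne τ hi]
        by_cases hc : τ j = false ∧ σ = Function.update (Function.update τ i true) j true
        · have hc' : True ∧ τ j = false ∧ i ≠ j ∧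
              σ = Function.update (Function.update τ i true) j true := ⟨trivial, hc.1, hij, hc.2⟩
          rw [if_pos hc, if_pos hc']
          ring
        · rw [if_neg hc, if_neg (fun h => hc ⟨h.2.1, h.2.2.2⟩), mul_zero]
    · simp
  rw [key u v, key v u, Finset.sum_comm, ← Finset.sum_neg_distrib]
  refine Finset.sum_congr rfl fun i _ => ?_
  rw [← Finset.sum_neg_distrib]
  refine Finset.sum_congr rfl fun j _ => ?_
  by_cases hij : i = j
  · simp [hij]
  · rw [Function.update_comm (Ne.symm hij)]
    by_cases hc : τ i = false ∧ τ j = false ∧ i ≠ j ∧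
          σ = Function.update (Function.update τ i true) j true
    · rw [if_pos hc, if_pos ⟨hc.2.1, hc.1, hc.2.2.1.symm, hc.2.2.2⟩]
      rcases lt_or_gt_of_ne hij with h | h
      · rw [if_neg h.not_gt, if_pos h]
        ring
      · rw [if_neg h.not_gt, if_pos h]
        ring
    · rw [if_neg hc, if_neg (fun h => hc ⟨h.2.1, h.1, h.2.2.1.symm, h.2.2.2⟩), neg_zero]

theorem creation_mul_self [IsDomain S] [CharZero S] {n : ℕ} (u : Fin n → S) :
    creation u * creation u = 0 := by
  ext σ τ
  exact self_eq_neg.mp (congrFun (congrFun (creation_anticommute u u) σ) τ)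

/-! ### Intertwining relation and Bethe vectors -/

/-- The quasi-periodic transfer matrix intertwines the creation operator of a plane wave whose
wave number is compatible with the boundary conditions. -/
theorem transferMatrix_mul_creation {n : ℕ} (a b x ξ q : S) (σ τ : Fin n → Bool)
    (hξ : ξ ^ n = (-1) ^ numOnes τ * q) :
    (1 - b * x * ξ) * (transferMatrix n (freeFermion a b x) q *
        creation fun j : Fin n => ξ ^ (n - (j + 1))) σ τ
      = (1 + a * x * ξ) * ((creation fun j : Fin n => ξ ^ (n - (j + 1))) *
        transferMatrix n (freeFermion a b x) (-q)) σ τ := by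
  have hw : ∀ j : Fin n, (fun i : Fin (n + 1) => ξ ^ (n - i : ℕ)) j.castSucc
      = ξ * (fun i : Fin (n + 1) => ξ ^ (n - i : ℕ)) j.succ := by
    intro j
    simp only [Fin.val_castSucc, Fin.val_succ, ← pow_succ']
    congr 1
    omega
  have hf := rowTransfer_telescope a b x ξ n (fun i => ξ ^ (n - i : ℕ)) hw σ τ false false
  have ht := rowTransfer_telescope a b x ξ n (fun i => ξ ^ (n - i : ℕ)) hw σ τ true true
  simp only [prod_parity, Fin.val_succ, Fin.val_last, Fin.val_zero, Nat.sub_self, Nat.sub_zero,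
    pow_zero, one_mul, if_true, Bool.false_eq_true, if_false, hξ, parity_true,
    parity_false, sub_zero, zero_sub] at hf ht
  rw [transferMatrix, transferMatrix, add_mul, mul_add, Matrix.smul_mul, Matrix.mul_smul]
  simp only [Matrix.add_apply, Matrix.smul_apply, smul_eq_mul, mul_creation_apply,
    creation_mul_apply]
  -- The end terms are multiples of the same entry with boundary values `true`, `false`, with
  -- coefficients proportional to `ξ ^ n` and to `q (-1) ^ numOnes τ`; they cancel by `hξ`. The
  -- factor `parity S true = -1` in `ht` produces the twist `-q`.
  linear_combination hf + q * ht

theorem creation_mulVec_mem_sector {n k : ℕ} (u : Fin n → S) {f : (Fin n → Bool) → S}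
    (hf : f ∈ sector S n k) : creation u *ᵥ f ∈ sector S n (k + 1) := by
  intro σ hσ
  refine Finset.sum_eq_zero fun τ _ => ?_
  by_cases hτ : numOnes τ = k
  · simp only [creation, Matrix.of_apply, Finset.sum_mul]
    refine Finset.sum_eq_zero fun j _ => ?_
    rw [if_neg, zero_mul]
    rintro ⟨h, rfl⟩
    exact hσ (by rw [numOnes_update h, hτ])
  · rw [hf τ hτ, mul_zero]

theorem transferMatrix_mulVec_creation {n k : ℕ} (a b x ξ q : S) {f : (Fin n → Bool) → S}
    (hf : f ∈ sector S n k) (hξ : ξ ^ n = (-1) ^ k * q) :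
    (1 - b * x * ξ) • transferMatrix n (freeFermion a b x) q *ᵥ
        ((creation fun j : Fin n => ξ ^ (n - (j + 1))) *ᵥ f)
      = (1 + a * x * ξ) • (creation fun j : Fin n => ξ ^ (n - (j + 1))) *ᵥ
        (transferMatrix n (freeFermion a b x) (-q) *ᵥ f) := by
  rw [Matrix.mulVec_mulVec, Matrix.mulVec_mulVec]
  ext σ
  simp only [Pi.smul_apply, smul_eq_mul, Matrix.mulVec, dotProduct, Finset.mul_sum]
  refine Finset.sum_congr rfl fun τ _ => ?_
  by_cases hτ : numOnes τ = k
  · rw [← mul_assoc, ← mul_assoc, transferMatrix_mul_creation]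
    rw [hξ, hτ]
  · simp only [hf τ hτ, mul_zero]

/-- The Bethe vector with the given wave numbers: a Slater determinant of plane waves. -/
def betheVector (n : ℕ) (l : List S) : (Fin n → Bool) → S :=
  l.foldr (fun ξ f => (creation fun j : Fin n => ξ ^ (n - (j + 1))) *ᵥ f)
    (Pi.single (fun _ => false) 1)

theorem betheVector_cons (n : ℕ) (ξ : S) (l : List S) :
    betheVector n (ξ :: l) = (creation fun j : Fin n => ξ ^ (n - (j + 1))) *ᵥ betheVector n l :=
  rfl

theorem numOnes_eq_zero_iff {n : ℕ} {σ : Fin n → Bool} : numOnes σ = 0 ↔ σ = fun _ => false := by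
  simp [numOnes, Bool.toNat_eq_zero, funext_iff]

theorem betheVector_mem_sector (n : ℕ) (l : List S) : betheVector n l ∈ sector S n l.length := by
  induction l with
  | nil =>
    intro σ hσ
    rw [List.length_nil, ne_eq, numOnes_eq_zero_iff] at hσ
    exact Pi.single_eq_of_ne hσ _
  | cons ξ l ih => exact creation_mulVec_mem_sector _ ih

/-- Stripping off one wave number reverses the sign of the twist and of `(-1) ^ l.length`, so `Q` is
the same at every stage; on the vacuum the twist is `-Q`. The denominators are cleared so that this
holds over any commutative ring. -/
theorem transferMatrix_mulVec_betheVector (n : ℕ) (a b x Q : S) (l : List S)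
    (hl : ∀ ξ ∈ l, ξ ^ n = Q) :
    (l.map fun ξ => 1 - b * x * ξ).prod •
        transferMatrix n (freeFermion a b x) (-((-1) ^ l.length * Q)) *ᵥ betheVector n l
      = ((1 - Q * (b * x) ^ n) * (l.map fun ξ => 1 + a * x * ξ).prod) • betheVector n l := by
  induction l with
  | nil =>
    ext σ
    have h := rowTransfer_vacuum n a b x
    by_cases hσ : σ = fun _ => false
    · subst hσ
      simp [betheVector, transferMatrix, h.1, h.2, sub_eq_add_neg]
    · have hne : numOnes σ ≠ numOnes (fun _ : Fin n => false) := by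
        rw [numOnes_eq_zero_iff.mpr rfl]
        exact fun h => hσ (numOnes_eq_zero_iff.mp h)
      simp [betheVector, transferMatrix, rowTransfer_eq_zero n _ _ _ _ hne, hσ]
  | cons ξ l ih =>
    have ih := ih fun η hη => hl η (List.mem_cons_of_mem _ hη)
    have hξ : ξ ^ n = (-1) ^ l.length * ((-1) ^ l.length * Q) := by
      rw [hl ξ List.mem_cons_self, ← mul_assoc, ← mul_pow]
      simp
    have hq : -((-1) ^ (ξ :: l).length * Q) = (-1) ^ l.length * Q := by
      rw [List.length_cons, pow_succ]
      ring
    rw [hq, List.map_cons, List.prod_cons, List.map_cons, List.prod_cons, betheVector_cons, mul_comm,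
      mul_smul, transferMatrix_mulVec_creation a b x ξ _ (betheVector_mem_sector n l) hξ,
      smul_comm, ← Matrix.mulVec_smul, ih, Matrix.mulVec_smul, smul_smul]
    congr 1
    ring

/-! ### Antisymmetry and spanning -/

theorem betheVector_perm (n : ℕ) {l l' : List S} (h : l.Perm l') :
    betheVector n l = betheVector n l' ∨ betheVector n l = -betheVector n l' := by
  induction h with
  | nil => exact Or.inl rfl
  | cons ξ _ ih =>
    rcases ih with h | h
    · exact Or.inl (by rw [betheVector_cons, h, betheVector_cons])
    · exact Or.inr (by rw [betheVector_cons, h, betheVector_cons, Matrix.mulVec_neg])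
  | swap ξ η l =>
    refine Or.inr ?_
    simp only [betheVector_cons, Matrix.mulVec_mulVec]
    rw [creation_anticommute, Matrix.neg_mulVec]
  | trans _ _ ih ih' => rcases ih with h | h <;> rcases ih' with h' | h' <;> simp [h, h']

/-- Pauli exclusion: a repeated wave number can be moved to the front at the cost of a sign, where
the creation operator is squared. -/
theorem betheVector_eq_zero [IsDomain S] [CharZero S] (n : ℕ) {l : List S} (h : ¬ l.Nodup) :
    betheVector n l = 0 := by
  obtain ⟨ξ, hξ⟩ := List.exists_duplicate_iff_not_nodup.mpr h
  obtain ⟨l', hl'⟩ := (List.duplicate_iff_sublist.mp hξ).exists_perm_append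
  have h0 : betheVector n ([ξ, ξ] ++ l') = 0 := by
    simp only [List.cons_append, List.nil_append, betheVector_cons, Matrix.mulVec_mulVec,
      creation_mul_self, Matrix.zero_mulVec]
  rcases betheVector_perm n hl' with h | h <;> rw [h, h0]
  exact neg_zero

theorem creation_sum {n : ℕ} {ι : Type*} (Z : Finset ι) (c : ι → S) (u : ι → Fin n → S) :
    creation (∑ ξ ∈ Z, c ξ • u ξ) = ∑ ξ ∈ Z, c ξ • creation (u ξ) := by
  ext σ τ
  simp only [creation, Matrix.of_apply, Matrix.sum_apply, Matrix.smul_apply, smul_eq_mul,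
    Finset.sum_apply, Pi.smul_apply, Finset.mul_sum]
  rw [Finset.sum_comm]
  refine Finset.sum_congr rfl fun j _ => ?_
  split_ifs
  · simp only [Finset.sum_mul, mul_assoc]
  · simp

theorem creation_single_mulVec {n : ℕ} (j : Fin n) {τ : Fin n → Bool} (hτ : τ j = false) :
    creation (Pi.single j (1 : S)) *ᵥ Pi.single τ 1
      = jordanWigner S τ j • Pi.single (Function.update τ j true) (1 : S) := by
  ext σ
  rw [Matrix.mulVec_single_one, Matrix.col_apply, creation, Matrix.of_apply,
    Finset.sum_eq_single j]
  · by_cases h : σ = Function.update τ j true <;> simp [h, hτ]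
  · intro i _ hi
    simp [hi]
  · simp

/-- If every coordinate vector is a combination of plane waves, then the Bethe vectors span
every sector. -/
theorem single_mem_span_betheVector (n : ℕ) (Z : Finset S)
    (hZ : ∀ j : Fin n, ∃ c : S → S,
      Pi.single j 1 = ∑ ξ ∈ Z, c ξ • fun i : Fin n => ξ ^ (n - (i + 1)))
    (k : ℕ) (σ : Fin n → Bool) (hσ : numOnes σ = k) :
    Pi.single σ (1 : S)
      ∈ Submodule.span S (betheVector n '' {l | l.length = k ∧ ∀ ξ ∈ l, ξ ∈ Z}) := by
  induction k generalizing σ with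
  | zero =>
    rw [numOnes_eq_zero_iff] at hσ
    subst hσ
    exact Submodule.subset_span ⟨[], by simp, rfl⟩
  | succ k ih =>
    obtain ⟨j, hj⟩ : ∃ j, σ j = true := by
      by_contra! h
      rw [numOnes_eq_zero_iff.mpr (funext fun j => by simpa using h j)] at hσ
      omega
    -- Emptying an occupied site `j` of `σ` gives `τ`, with one letter `1` fewer. Creating at `j`
    -- recovers `σ` up to a sign, and the creation operator at `j` is a combination of plane-wave
    -- ones by `hZ`.
    obtain ⟨hτ, hστ⟩ := (eq_update_true_iff σ (Function.update σ j false) j).mpr ⟨hj, rfl⟩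
    set τ := Function.update σ j false
    have hτk : numOnes τ = k := by
      have := numOnes_update hτ
      rw [← hστ, hσ] at this
      omega
    obtain ⟨c, hc⟩ := hZ j
    have hmem : creation (Pi.single j (1 : S)) *ᵥ Pi.single τ 1
        ∈ Submodule.span S (betheVector n '' {l | l.length = k + 1 ∧ ∀ ξ ∈ l, ξ ∈ Z}) := by
      rw [hc, creation_sum, Matrix.sum_mulVec]
      refine Submodule.sum_mem _ fun ξ hξ => ?_
      rw [Matrix.smul_mulVec]
      refine Submodule.smul_mem _ _ ?_
      have := Submodule.mem_map_of_mem
        (f := (creation fun i : Fin n => ξ ^ (n - (i + 1))).mulVecLin) (ih τ hτk)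
      rw [Submodule.map_span, ← Set.image_comp] at this
      refine Submodule.span_mono ?_ this
      rintro _ ⟨l, ⟨hl, hlZ⟩, rfl⟩
      exact ⟨ξ :: l, ⟨by simp [hl], by simpa using ⟨hξ, hlZ⟩⟩, rfl⟩
    rw [creation_single_mulVec j hτ, ← hστ] at hmem
    have := Submodule.smul_mem _ (jordanWigner S τ j) hmem
    rwa [smul_smul, jordanWigner_mul_self, one_smul] at this

/-- Passes from lists to sets of wave numbers: repetitions give zero, and the order affects only the
sign. -/
theorem betheVector_mem_span_toList [IsDomain S] [CharZero S] (n k : ℕ) (Z : Finset S) (l : List S)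
    (hl : l.length = k) (hlZ : ∀ ξ ∈ l, ξ ∈ Z) :
    betheVector n l ∈ Submodule.span S
      ((fun s : Finset S => betheVector n s.toList) '' {s | s.card = k ∧ s ⊆ Z}) := by
  classical
  by_cases h : l.Nodup
  · have hmem : betheVector n l.toFinset.toList ∈ Submodule.span S
        ((fun s : Finset S => betheVector n s.toList) '' {s | s.card = k ∧ s ⊆ Z}) := by
      refine Submodule.subset_span ⟨l.toFinset, ⟨?_, fun ξ hξ => hlZ ξ (by simpa using hξ)⟩, rfl⟩
      rw [List.toFinset_card_of_nodup h, hl]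
    rcases betheVector_perm n (List.toFinset_toList h).symm with h | h <;> rw [h]
    · exact hmem
    · exact Submodule.neg_mem _ hmem
  · rw [betheVector_eq_zero n h]
    exact Submodule.zero_mem _

/-! ### Rank of the sectors and extension of scalars -/

theorem eq_sum_smul_single {n k : ℕ} {f : (Fin n → Bool) → S} (hf : f ∈ sector S n k) :
    f = ∑ σ with numOnes σ = k, f σ • Pi.single σ (1 : S) := by
  ext τ
  rw [Finset.sum_apply]
  by_cases hτ : numOnes τ = k
  · rw [Finset.sum_eq_single τ]
    · simp
    · intro σ _ hσ
      simp [hσ.symm]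
    · simp [hτ]
  · rw [hf τ hτ, Finset.sum_eq_zero]
    intro σ hσ
    have : τ ≠ σ := by
      rintro rfl
      exact hτ (by simpa using hσ)
    simp [this]

/-- The coordinates on a sector. -/
def sectorEquiv (S : Type*) [CommRing S] (n k : ℕ) :
    sector S n k ≃ₗ[S] ({σ : Fin n → Bool // numOnes σ = k} → S) where
  toFun f σ := (f : (Fin n → Bool) → S) σ
  map_add' _ _ := rfl
  map_smul' _ _ := rfl
  invFun g := ⟨fun σ => if h : numOnes σ = k then g ⟨σ, h⟩ else 0, fun σ hσ => by simp [hσ]⟩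
  left_inv f := by
    ext σ
    by_cases h : numOnes σ = k
    · simp [h]
    · simp [h, f.2 σ h]
  right_inv g := by
    ext σ
    simp [σ.2]

theorem card_numOnes_eq (n k : ℕ) :
    Fintype.card {σ : Fin n → Bool // numOnes σ = k} = n.choose k := by
  let e : (Fin n → Bool) ≃ Finset (Fin n) :=
    { toFun := fun σ => Finset.univ.filter fun i => σ i = true
      invFun := fun s i => decide (i ∈ s)
      left_inv := fun σ => by ext i; simp
      right_inv := fun s => by ext i; simp }
  have h := Fintype.card_finset_len (α := Fin n) k
  rw [Fintype.card_fin] at h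
  rw [← h]
  refine Fintype.card_congr (e.subtypeEquiv fun σ => ?_)
  have : numOnes σ = (e σ).card := by
    simp only [numOnes, e, Equiv.coe_fn_mk, Finset.card_filter]
    refine Finset.sum_congr rfl fun i _ => ?_
    cases σ i <;> simp
  rw [this]

instance (n k : ℕ) : Module.Finite S (sector S n k) :=
  Module.Finite.equiv (sectorEquiv S n k).symm

theorem finrank_sector [Nontrivial S] (n k : ℕ) :
    Module.finrank S (sector S n k) = n.choose k := by
  rw [(sectorEquiv S n k).finrank_eq, Module.finrank_fintype_fun_eq_card, card_numOnes_eq]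

/-- A basis vector of a sector. -/
def sectorSingle (S : Type*) [CommRing S] {n k : ℕ} (σ : Fin n → Bool) (hσ : numOnes σ = k) :
    sector S n k :=
  ⟨Pi.single σ 1, fun τ hτ => Pi.single_eq_of_ne (fun h => hτ (by rw [h, hσ])) _⟩

theorem span_sectorSingle (n k : ℕ) (N : Submodule S (sector S n k))
    (h : ∀ σ (hσ : numOnes σ = k), sectorSingle S σ hσ ∈ N) : N = ⊤ := by
  rw [eq_top_iff]
  intro f _
  have hf : (f : (Fin n → Bool) → S) ∈ N.map (sector S n k).subtype := by
    rw [eq_sum_smul_single f.2]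
    refine Submodule.sum_mem _ fun σ hσ => Submodule.smul_mem _ _ ?_
    exact ⟨sectorSingle S σ (by simpa using hσ), h _ _, rfl⟩
  obtain ⟨g, hg, hgf⟩ := hf
  rwa [← Subtype.ext hgf]

/-- The standard basis vectors over `L` come from `R`, so it is enough to span those. -/
theorem span_sectorMap {R L ι : Type*} [CommRing R] [CommRing L] [Algebra R L] {n k : ℕ}
    (v : ι → sector R n k) (hv : Submodule.span R (Set.range v) = ⊤) :
    Submodule.span L (Set.range fun i => sectorMap L (v i)) = ⊤ := by
  refine span_sectorSingle n k _ fun σ hσ => ?_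
  let φ : sector R n k →ₗ[R] sector L n k :=
    { toFun := sectorMap L
      map_add' := fun f g => by ext τ; simp [sectorMap]
      map_smul' := fun c f => by ext τ; simp [sectorMap, Algebra.smul_def] }
  have h1 : sectorSingle L σ hσ = φ (sectorSingle R σ hσ) := by
    ext τ
    by_cases h : τ = σ
    · subst h; simp [φ, sectorMap, sectorSingle]
    · simp [φ, sectorMap, sectorSingle, h]
  have h2 : φ (sectorSingle R σ hσ) ∈ Submodule.span R (Set.range fun i => sectorMap L (v i)) := by
    have : φ (sectorSingle R σ hσ) ∈ (Submodule.span R (Set.range v)).map φ :=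
      Submodule.mem_map_of_mem (by rw [hv]; trivial)
    rwa [Submodule.map_span, ← Set.range_comp] at this
  rw [h1]
  exact Submodule.span_subset_span R L _ h2

/-! ### Completeness of the plane waves -/

/-- Inverse discrete Fourier transform: the coordinate vectors are combinations of the plane waves
whose wave numbers are the `n`-th roots of a unit. -/
theorem single_eq_sum_planeWave {R : Type*} [CommRing R] [IsDomain R] {n : ℕ} {ζ α Q : R}
    (hζ : IsPrimitiveRoot ζ n) (hα : α ^ n = Q) (hQ : IsUnit Q) (hn : IsUnit (n : R))
    (Z : Finset R) (hZ : Z.val = nthRoots n Q) (j : Fin n) :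
    ∃ c : R → R, Pi.single j 1 = ∑ ξ ∈ Z, c ξ • fun i : Fin n => ξ ^ (n - (i + 1)) := by
  obtain ⟨d, hd⟩ := (hn.mul hQ).exists_left_inv
  -- Here `d` inverts `nQ`. The `i`-th entry is `d` times the sum of `ξ ^ (n + j - i)` over the
  -- roots, which is `nQ` for `i = j` and `0` otherwise.
  refine ⟨fun ξ => d * ξ ^ (j + 1 : ℕ), ?_⟩
  ext i
  have hi := i.2
  have hj := j.2
  have hsum : ∑ ξ ∈ Z, ξ ^ (j + 1 + (n - (i + 1)) : ℕ)
      = (∑ r ∈ Finset.range n, (ζ ^ (j + 1 + (n - (i + 1)) : ℕ)) ^ r)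
        * α ^ (j + 1 + (n - (i + 1)) : ℕ) := by
    rw [Finset.sum, hZ, hζ.nthRoots_eq hα, Multiset.map_map, Finset.sum_mul, Finset.sum]
    congr 1
    refine Multiset.map_congr rfl fun r _ => ?_
    simp only [Function.comp_apply]
    rw [mul_pow, pow_right_comm]
  have hc : (∑ ξ ∈ Z, (d * ξ ^ (j + 1 : ℕ)) • fun i : Fin n => ξ ^ (n - (i + 1) : ℕ)) i
      = d * ∑ ξ ∈ Z, ξ ^ (j + 1 + (n - (i + 1)) : ℕ) := by
    rw [Finset.sum_apply, Finset.mul_sum]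
    refine Finset.sum_congr rfl fun ξ _ => ?_
    rw [Pi.smul_apply, smul_eq_mul, pow_add _ (j + 1 : ℕ), mul_assoc]
  rw [hc, hsum]
  rcases eq_or_ne i j with rfl | hij
  · have hm : (i : ℕ) + 1 + (n - (i + 1)) = n := by omega
    rw [hm, hζ.pow_eq_one, hα]
    simp [hd]
  · have hne : ζ ^ (j + 1 + (n - (i + 1)) : ℕ) ≠ 1 := by
      rw [ne_eq, hζ.pow_eq_one_iff_dvd]
      rintro ⟨e, he⟩
      have hij' : (i : ℕ) ≠ j := fun h => hij (Fin.ext h)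
      -- The exponent `n + j - i` lies strictly between `0` and `2n`; the only multiple of `n` there
      -- is `n`, which would force `i = j`.
      have h1 : 0 < e := Nat.pos_of_ne_zero (by rintro rfl; omega)
      have h2 : e < 2 := by
        by_contra! h
        have := Nat.mul_le_mul_left n h
        omega
      obtain rfl : e = 1 := by omega
      omega
    have h0 : ∑ r ∈ Finset.range n, (ζ ^ (j + 1 + (n - (i + 1)) : ℕ)) ^ r = 0 := by
      refine eq_zero_of_ne_zero_of_mul_right_eq_zero (sub_ne_zero_of_ne hne) ?_
      rw [geom_sum_mul, pow_right_comm, hζ.pow_eq_one, one_pow, sub_self]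
    rw [h0, zero_mul, mul_zero, Pi.single_eq_of_ne hij]

/-! ### Eigenvalues over the field of rational functions -/

/-- The eigenvalue equation over a field, for wave numbers that avoid the poles. -/
theorem transferMatrix_mulVec_betheVector_eq_smul {K : Type*} [Field K] {n k : ℕ} (q a b x : K) (s : Finset K)
    (hs : s.card = k) (hξ : ∀ ξ ∈ s, ξ ^ n + (-1) ^ k * q = 0)
    (hpole : ∀ ξ ∈ s, 1 - b * x * ξ ≠ 0) (l : List K) (hl : l.Perm s.toList) :
    transferMatrix n (freeFermion a b x) q *ᵥ betheVector n l
      = ((1 + (-1) ^ k * q * x ^ n * b ^ n) * ∏ ξ ∈ s, (1 + a * x * ξ) / (1 - b * x * ξ)) •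
        betheVector n l := by
  have hmem : ∀ ξ ∈ l, ξ ∈ s := fun ξ h => by simpa using hl.subset h
  have hlen : l.length = k := by rw [hl.length_eq, Finset.length_toList, hs]
  have hprod (g : K → K) : (l.map g).prod = ∏ ξ ∈ s, g ξ := by
    rw [(hl.map g).prod_eq, Finset.prod_map_toList]
  have h := transferMatrix_mulVec_betheVector n a b x (-((-1) ^ k * q)) l
    fun ξ h => eq_neg_of_add_eq_zero_left (hξ ξ (hmem ξ h))
  have hq : -((-1) ^ l.length * -((-1) ^ k * q)) = q := by
    rw [hlen, mul_neg, neg_neg, ← mul_assoc, ← mul_pow]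
    simp
  rw [hq, hprod, hprod] at h
  have hne : ∏ ξ ∈ s, (1 - b * x * ξ) ≠ 0 := Finset.prod_ne_zero_iff.mpr hpole
  rw [Finset.prod_div_distrib, ← inv_smul_smul₀ hne (transferMatrix _ _ _ *ᵥ _), h, smul_smul]
  congr 1
  field_simp
  ring

theorem betheVector_map {R L : Type*} [CommRing R] [CommRing L] (f : R →+* L) (n : ℕ) (l : List R) :
    betheVector n (l.map f) = fun σ => f (betheVector n l σ) := by
  induction l with
  | nil =>
    ext σ
    by_cases h : σ = fun _ => false <;> simp [betheVector, h]
  | cons ξ l ih =>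
    ext σ
    rw [List.map_cons, betheVector_cons, betheVector_cons, ih]
    simp only [Matrix.mulVec, dotProduct, map_sum, map_mul]
    refine Finset.sum_congr rfl fun τ _ => ?_
    congr 1
    simp only [creation, Matrix.of_apply, map_sum]
    refine Finset.sum_congr rfl fun j _ => ?_
    split_ifs
    · rw [map_mul, map_pow, jordanWigner, jordanWigner, map_prod]
      congr 1
      refine Finset.prod_congr rfl fun i _ => ?_
      cases σ i <;> cases τ i <;> split_ifs <;> simp
    · simp

/-- An endomorphism with a basis of eigenvectors has no further eigenvalues. -/
theorem hasEigenvalue_iff_of_basis {K V ι : Type*} [Field K] [AddCommGroup V] [Module K V]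
    [Finite ι] (b : Module.Basis ι K V) (T : Module.End K V) (d : ι → K)
    (h : ∀ i, T (b i) = d i • b i) (μ : K) : T.HasEigenvalue μ ↔ ∃ i, μ = d i := by
  classical
  have := Fintype.ofFinite ι
  have hT : T = Matrix.toLin b b (Matrix.diagonal d) :=
    b.ext fun i => by simp [h, Matrix.toLin_self, Matrix.diagonal_apply]
  rw [hT, hasEigenvalue_toLin_diagonal_iff]
  simp only [eq_comm]

end SixVertex

end

theorem mainTheorem10 {R : Type*} [CommRing R] [IsDomain R] [Algebra ℂ R]
    (n k : ℕ) (hn : 1 ≤ n) (hk : k ≤ n) (q : R) (hq : IsUnit q) (hroot : ∃ p : R, p ^ n = q)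
    (a b : R) :
    -- the Bethe ansatz equations have `n.choose k = dim V_k` solutions
    Nat.card (SixVertex.BetheSolution R n k q) = n.choose k ∧
    -- `τ(x; a, b)` is diagonalisable on `V_k`, by a basis of eigenvectors free of `x`
    (∃ v : Module.Basis (SixVertex.BetheSolution R n k q) R (SixVertex.sector R n k),
      ∀ s : SixVertex.BetheSolution R n k q,
        SixVertex.sectorTransfer n k
            (algebraMap R (SixVertex.SpectralField R) q)
            (algebraMap R (SixVertex.SpectralField R) a)
            (algebraMap R (SixVertex.SpectralField R) b)
            (SixVertex.spectralX R)
            (SixVertex.sectorMap (SixVertex.SpectralField R) (v s)) =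
          SixVertex.betheEigenvalue n k q a b s.1 •
            SixVertex.sectorMap (SixVertex.SpectralField R) (v s)) ∧
    -- the eigenvalues are exactly those given by the solutions of the Bethe ansatz equations
    (∀ μ : SixVertex.SpectralField R,
      Module.End.HasEigenvalue
          (SixVertex.sectorTransfer n k
            (algebraMap R (SixVertex.SpectralField R) q)
            (algebraMap R (SixVertex.SpectralField R) a)
            (algebraMap R (SixVertex.SpectralField R) b)
            (SixVertex.spectralX R)) μ ↔
        ∃ s : SixVertex.BetheSolution R n k q,
          μ = SixVertex.betheEigenvalue n k q a b s.1) := by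
  classical
  obtain ⟨p, hp⟩ := hroot
  have hn0 : n ≠ 0 := by omega
  have hinj : Function.Injective (algebraMap ℂ R) := (algebraMap ℂ R).injective
  have : CharZero R := charZero_of_injective_algebraMap hinj
  -- the set of all roots
  set Q : R := -((-1) ^ k * q) with hQdef
  have hQ : IsUnit Q := ((isUnit_one.neg.pow k).mul hq).neg
  -- The sign in `Q = -(-1) ^ k q` has an `n`-th root in `ℂ`; multiplied by `p` it yields an `n`-th
  -- root of `Q` in `R`.
  obtain ⟨z, hz⟩ := IsAlgClosed.exists_pow_nat_eq (-(-1) ^ k : ℂ) hn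
  have hα : (algebraMap ℂ R z * p) ^ n = Q := by
    rw [mul_pow, ← map_pow, hz, hp, hQdef]
    simp
  have hζ : IsPrimitiveRoot (algebraMap ℂ R (Complex.exp (2 * Real.pi * Complex.I / n))) n :=
    (Complex.isPrimitiveRoot_exp n hn0).map_of_injective hinj
  let Z : Finset R := ⟨nthRoots n Q, hζ.nthRoots_nodup hQ.ne_zero⟩
  have hZcard : Z.card = n := by
    rw [Finset.card_mk, hζ.card_nthRoots, if_pos ⟨_, hα⟩]
  have hZmem (ξ : R) : ξ ∈ Z ↔ ξ ^ n + (-1) ^ k * q = 0 := by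
    rw [Finset.mem_mk, mem_nthRoots (by omega), hQdef, eq_neg_iff_add_eq_zero]
  have hsol (s : Finset R) : (s.card = k ∧ ∀ ξ ∈ s, ξ ^ n + (-1) ^ k * q = 0)
      ↔ s ∈ Finset.powersetCard k Z := by
    rw [Finset.mem_powersetCard, and_comm]
    simp only [Finset.subset_iff, hZmem]
  let e : SixVertex.BetheSolution R n k q ≃ Finset.powersetCard k Z :=
    Equiv.subtypeEquivRight hsol
  have hcard : Nat.card (SixVertex.BetheSolution R n k q) = n.choose k := by
    rw [Nat.card_congr e, Nat.card_eq_fintype_card, Fintype.card_coe, Finset.card_powersetCard,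
      hZcard]
  have : Finite (SixVertex.BetheSolution R n k q) := Finite.of_equiv _ e.symm
  have := Fintype.ofFinite (SixVertex.BetheSolution R n k q)
  rw [Nat.card_eq_fintype_card] at hcard
  -- the Bethe vectors form a basis
  let B (s : SixVertex.BetheSolution R n k q) : SixVertex.sector R n k :=
    ⟨SixVertex.betheVector n s.1.toList, by
      have := SixVertex.betheVector_mem_sector n s.1.toList
      rwa [Finset.length_toList, s.2.1] at this⟩
  have hnunit : IsUnit (n : R) := by
    have : IsUnit (algebraMap ℂ R n) := (IsUnit.mk0 (n : ℂ) (by exact_mod_cast hn0)).map _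
    simpa using this
  have hspan : Submodule.span R (Set.range B) = ⊤ := by
    refine SixVertex.span_sectorSingle n k _ fun σ hσ => ?_
    have h1 := SixVertex.single_mem_span_betheVector n Z
      (SixVertex.single_eq_sum_planeWave hζ hα hQ hnunit Z rfl) k σ hσ
    have h2 : Pi.single σ (1 : R) ∈ (Submodule.span R (Set.range B)).map
        (SixVertex.sector R n k).subtype := by
      rw [Submodule.map_span, ← Set.range_comp]
      refine Submodule.span_le.mpr ?_ h1
      rintro _ ⟨l, ⟨hl, hlZ⟩, rfl⟩
      refine Submodule.span_mono ?_ (SixVertex.betheVector_mem_span_toList n k Z l hl hlZ)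
      rintro _ ⟨s, ⟨hs, hsZ⟩, rfl⟩
      exact ⟨⟨s, hs, fun ξ hξ => (hZmem ξ).mp (hsZ hξ)⟩, rfl⟩
    obtain ⟨g, hg, hgσ⟩ := h2
    have : SixVertex.sectorSingle R σ hσ = g := Subtype.ext hgσ.symm
    rwa [this]
  let v := basisOfTopLeSpanOfCardEqFinrank B hspan.ge (by rw [hcard, SixVertex.finrank_sector])
  have hv : ⇑v = B := coe_basisOfTopLeSpanOfCardEqFinrank ..
  -- over the field of rational functions
  let vK := basisOfTopLeSpanOfCardEqFinrank
    (fun s => SixVertex.sectorMap (SixVertex.SpectralField R) (B s))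
    (SixVertex.span_sectorMap B hspan).ge (by rw [hcard, SixVertex.finrank_sector])
  have hvK : ⇑vK = fun s => SixVertex.sectorMap (SixVertex.SpectralField R) (B s) :=
    coe_basisOfTopLeSpanOfCardEqFinrank ..
  have hιinj : Function.Injective (algebraMap R (SixVertex.SpectralField R)) := by
    rw [IsScalarTower.algebraMap_eq R R[X] (SixVertex.SpectralField R)]
    exact (IsFractionRing.injective R[X] _).comp C_injective
  have hpole (ξ : R) : 1 - algebraMap R (SixVertex.SpectralField R) b * SixVertex.spectralX R
      * algebraMap R (SixVertex.SpectralField R) ξ ≠ 0 := by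
    have h : algebraMap R[X] (SixVertex.SpectralField R) (1 - C b * X * C ξ) ≠ 0 := by
      rw [ne_eq, map_eq_zero_iff _ (IsFractionRing.injective R[X] _)]
      intro h
      -- At `x = 0` the denominator equals `1`, so it is not the zero polynomial.
      simpa using congrArg (eval 0) h
    simpa [SixVertex.spectralX, IsScalarTower.algebraMap_apply R R[X] (SixVertex.SpectralField R)]
      using h
  have heig (s : SixVertex.BetheSolution R n k q) :
      SixVertex.sectorTransfer n k (algebraMap R (SixVertex.SpectralField R) q)
          (algebraMap R (SixVertex.SpectralField R) a)
          (algebraMap R (SixVertex.SpectralField R) b) (SixVertex.spectralX R)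
          (SixVertex.sectorMap (SixVertex.SpectralField R) (B s)) =
        SixVertex.betheEigenvalue n k q a b s.1 •
          SixVertex.sectorMap (SixVertex.SpectralField R) (B s) := by
    have h := SixVertex.transferMatrix_mulVec_betheVector_eq_smul (n := n) (k := k)
      (algebraMap R (SixVertex.SpectralField R) q)
      (algebraMap R (SixVertex.SpectralField R) a)
      (algebraMap R (SixVertex.SpectralField R) b) (SixVertex.spectralX R)
      (s.1.map ⟨_, hιinj⟩) (by rw [Finset.card_map, s.2.1])
      (by
        intro ξ hξ
        obtain ⟨η, hη, rfl⟩ := Finset.mem_map.mp hξ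
        simpa using congrArg (algebraMap R (SixVertex.SpectralField R)) (s.2.2 η hη))
      (by
        intro ξ hξ
        obtain ⟨η, hη, rfl⟩ := Finset.mem_map.mp hξ
        exact hpole η)
      -- The image of the list chosen for `s` need not be the list chosen for the image of `s`, only
      -- a permutation of it.
      (s.1.toList.map (algebraMap R (SixVertex.SpectralField R)))
      (by
        rw [← Multiset.coe_eq_coe, ← Multiset.map_coe, Finset.coe_toList, Finset.coe_toList]
        rfl)
    rw [SixVertex.betheVector_map, Finset.prod_map] at h
    exact Subtype.ext h
  refine ⟨by rw [Nat.card_eq_fintype_card, hcard], ⟨v, fun s => by rw [hv]; exact heig s⟩,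
    fun μ => ?_⟩
  exact SixVertex.hasEigenvalue_iff_of_basis vK _
    (fun s => SixVertex.betheEigenvalue n k q a b s.1) (fun s => by rw [hvK]; exact heig s) μ
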